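/- **Terms and values.** Let $At$ and $Lb$ be sets (of atoms and of labels). *Terms* are given by $t ::= l \mid \prod S \mid \sum S \mid t_1\cdot t_2 \mid {\sim} t_1$, where $l\in Lb$ and $S$ is any (possibly empty, possibly infinite) set of terms; write $1=\prod\emptyset$, $0=\sum\emptyset$, and $t*u=\prod\{t,u\}$, $t+u=\sum\{t,u\}$. A term is *elementary* if it is $l$, ${\sim}l$ or ${\sim}{\sim}l$ with $l\in Lb$. The set $\mathbf V_{Lb}$ of *(causal) values* is the set of equivalence classes $[t]$ of terms under the axioms of a completely distributive complete lattice with meets $\prod$ and joins $\sum$, together with the following axioms. * $t\cdot(u\cdot w)=(t\cdot u)\cdot w$; $\; t=t+u\cdot t\cdot w$; $\; u\cdot t\cdot w=t*(u\cdot t\cdot w)$; $\; 1\cdot t=t=t\cdot 1$; $\; t\cdot 0=0=0\cdot t$; $\; x\cdot x=x$ for $x$ elementary. * $t\cdot\sum_i u_i=\sum_i t\cdot u_i$ and $(\sum_i u_i)\cdot t=\sum_i u_i\cdot t$. * For terms $c,d,e,d_i$ in which no sum occurs: $c\cdot d\cdot e=(c\cdot d)*(d\cdot e)$ if $d\ne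 1$ (that is, if $d=1$ is not derivable from the other axioms); $\; c\cdot\prod_i d_i=\prod_i c\cdot d_i$ and $(\prod_i d_i)\cdot e=\prod_i d_i\cdot e$ for non-empty families. * $t*{\sim}t=0$; $\; {\sim}{\sim}{\sim}t={\sim}t$; $\; {\sim}(t+u)={\sim}t*{\sim}u$; $\; {\sim}(t*u)={\sim}t+{\sim}u$; $\; {\sim}t+{\sim}{\sim}t=1$; $\; {\sim}(t\cdot u)={\sim}(t*u)$. Values are ordered by $t\le u$ iff $t*u=t$ (equivalently $t+u=u$). **Programs and models.** A *positive (labelled logic) program* $P$ over $(At,Lb)$ is a (possibly infinite) set of rules $r: H\leftarrow B_1,\dots,B_m$ with $m\ge 0$, $r\in Lb$ or $r=1$, $H\in At$, and each $B_j$ an atom or a term. An *interpretation* is a map $I:At\to\mathbf V_{Lb}$, extended to terms by $I(t)=[t]$; interpretations are ordered pointwise, and sums of interpretations are taken pointwise. $I$ is a *causal model* of $P$ if $(I(B_1)*\dots*I(B_m))\cdot r\le I(H)$ for every rule of $P$. The direct consequence operator $T_P$ is $$T_P(I)(H)=\sum\big\{(I(B_1)*\dots*I(B_m))\cdot r \;\big|\;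 (r:H\leftarrow B_1,\dots,B_m)\in P\big\},$$ and $T_P{\uparrow}\alpha=T_P(T_P{\uparrow}(\alpha-1))$ for successor ordinals $\alpha$, $T_P{\uparrow}\alpha=\sum_{\beta<\alpha}T_P{\uparrow}\beta$ for $\alpha$ zero or a limit ordinal; in particular $T_P{\uparrow}0$ maps every atom to $0$. **Theorem.** Let $P$ be a (possibly infinite) positive labelled logic program. Then: (i) $T_P$ has a least fixpoint $\mathrm{lfp}(T_P)$; it satisfies $\mathrm{lfp}(T_P)=T_P{\uparrow}\omega$, and it is the $\le$-least causal model of $P$. (ii) If moreover $P$ has exactly $n$ rules, for some $n\in\mathbb N$, then $\mathrm{lfp}(T_P)=T_P{\uparrow}\omega=T_P{\uparrow}n$. -/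

import Mathlib

universe u

namespace ECJ

/-- Causal terms over a set `Lb` of labels.  The operands of a sum or product form an arbitrary
(possibly empty or infinite) set of terms, presented as the range of a family indexed by a type in
the universe of `Lb`; families with the same range give equal values. -/
inductive Term (Lb : Type u) : Type (u + 1) where
  | label (l : Lb) : Term Lb
  | prod {ι : Type u} (f : ι → Term Lb) : Term Lb
  | sum {ι : Type u} (f : ι → Term Lb) : Term Lb
  | app (t w : Term Lb) : Term Lb
  | neg (t : Term Lb) : Term Lb

namespace Term

variable {Lb : Type u}

/-- The empty product `1`. -/
def one : Term Lb := prod (fun i : PEmpty.{u + 1} => i.elim)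

/-- The empty sum `0`. -/
def zero : Term Lb := sum (fun i : PEmpty.{u + 1} => i.elim)

/-- The binary product `t * w`. -/
def mul (t w : Term Lb) : Term Lb := prod (fun b : ULift.{u} Bool => cond b.down t w)

/-- The binary sum `t + w`. -/
def add (t w : Term Lb) : Term Lb := sum (fun b : ULift.{u} Bool => cond b.down t w)

/-- Elementary terms: `l`, `∼l` and `∼∼l` for a label `l`. -/
inductive IsElementary : Term Lb → Prop
  | label (l : Lb) : IsElementary (label l)
  | neg (l : Lb) : IsElementary (neg (label l))
  | neg_neg (l : Lb) : IsElementary (neg (neg (label l)))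

/-- Terms in which no sum occurs. -/
def SumFree : Term Lb → Prop
  | label _ => True
  | prod f => ∀ i, (f i).SumFree
  | sum _ => False
  | app t w => t.SumFree ∧ w.SumFree
  | neg t => t.SumFree

/-- The equational axioms of causal values, apart from those saying that sums and products are
suprema and infima.  The parameter `D` says for which middle terms `d` the law
`c · d · e = (c · d) * (d · e)` is imposed. -/
inductive Ax (D : Term Lb → Prop) : Term Lb → Term Lb → Prop
  -- complete distributivity
  | distrib {ι : Type u} {κ : ι → Type u} (f : ∀ i, κ i → Term Lb) :
      Ax D (prod fun i => sum fun j => f i j)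
        (sum fun g : (∀ i, κ i) => prod fun i => f i (g i))
  -- application
  | app_assoc (t v w : Term Lb) : Ax D (app t (app v w)) (app (app t v) w)
  | absorb_add (t v w : Term Lb) : Ax D t (add t (app (app v t) w))
  | absorb_mul (t v w : Term Lb) : Ax D (app (app v t) w) (mul t (app (app v t) w))
  | one_app (t : Term Lb) : Ax D t (app one t)
  | app_one (t : Term Lb) : Ax D t (app t one)
  | app_zero (t : Term Lb) : Ax D zero (app t zero)
  | zero_app (t : Term Lb) : Ax D zero (app zero t)
  | idem (x : Term Lb) : IsElementary x → Ax D (app x x) x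
  | app_sum {ι : Type u} (t : Term Lb) (f : ι → Term Lb) :
      Ax D (app t (sum f)) (sum fun i => app t (f i))
  | sum_app {ι : Type u} (f : ι → Term Lb) (w : Term Lb) :
      Ax D (app (sum f) w) (sum fun i => app (f i) w)
  | app_mid (c d e : Term Lb) : SumFree c → SumFree d → SumFree e → D d →
      Ax D (app (app c d) e) (mul (app c d) (app d e))
  | app_prod {ι : Type u} [Nonempty ι] (c : Term Lb) (f : ι → Term Lb) :
      SumFree c → (∀ i, SumFree (f i)) → Ax D (app c (prod f)) (prod fun i => app c (f i))
  | prod_app {ι : Type u} [Nonempty ι] (f : ι → Term Lb) (e : Term Lb) :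
      (∀ i, SumFree (f i)) → SumFree e → Ax D (app (prod f) e) (prod fun i => app (f i) e)
  -- negation
  | mul_neg (t : Term Lb) : Ax D (mul t (neg t)) zero
  | neg_neg_neg (t : Term Lb) : Ax D (neg (neg (neg t))) (neg t)
  | neg_add (t w : Term Lb) : Ax D (neg (add t w)) (mul (neg t) (neg w))
  | neg_mul (t w : Term Lb) : Ax D (neg (mul t w)) (add (neg t) (neg w))
  | weak_em (t : Term Lb) : Ax D (add (neg t) (neg (neg t))) one
  | neg_app (t w : Term Lb) : Ax D (neg (app t w)) (neg (mul t w))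

/-- Derivable inequality: the least preorder that validates the axioms, in which `sum` is the
supremum and `prod` the infimum, and whose associated equivalence is a congruence for application
and negation (for sums and products this is automatic). -/
inductive Le (D : Term Lb → Prop) : Term Lb → Term Lb → Prop
  | refl (t : Term Lb) : Le D t t
  | trans {t v w : Term Lb} : Le D t v → Le D v w → Le D t w
  | le_sum {ι : Type u} (f : ι → Term Lb) (i : ι) : Le D (f i) (sum f)
  | sum_le {ι : Type u} (f : ι → Term Lb) (t : Term Lb) : (∀ i, Le D (f i) t) → Le D (sum f) t
  | prod_le {ι : Type u} (f : ι → Term Lb) (i : ι) : Le D (prod f) (f i)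
  | le_prod {ι : Type u} (f : ι → Term Lb) (t : Term Lb) : (∀ i, Le D t (f i)) → Le D t (prod f)
  | ax {t w : Term Lb} : Ax D t w → Le D t w
  | ax_symm {t w : Term Lb} : Ax D t w → Le D w t
  | app_congr {t t' w w' : Term Lb} : Le D t t' → Le D t' t → Le D w w' → Le D w' w →
      Le D (app t w) (app t' w')
  | neg_congr {t t' : Term Lb} : Le D t t' → Le D t' t → Le D (neg t) (neg t')

/-- The term equals `1` by the axioms other than `c · d · e = (c · d) * (d · e)`. -/
def IsOne (t : Term Lb) : Prop := Le (fun _ => False) one t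

/-- The order on causal terms: `c · d · e = (c · d) * (d · e)` is imposed when `d ≠ 1`. -/
def CLe : Term Lb → Term Lb → Prop := Le (fun d => ¬ IsOne d)

/-- Equivalence of causal terms. -/
instance setoid (Lb : Type u) : Setoid (Term Lb) where
  r t w := CLe t w ∧ CLe w t
  iseqv :=
    { refl := fun t => ⟨Le.refl t, Le.refl t⟩
      symm := fun h => ⟨h.2, h.1⟩
      trans := fun h k => ⟨Le.trans h.1 k.1, Le.trans k.2 h.2⟩ }

theorem mul_le {D : Term Lb → Prop} {t w : Term Lb} : Le D (mul t w) t ∧ Le D (mul t w) w :=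
  ⟨Le.prod_le (fun b : ULift.{u} Bool => cond b.down t w) ⟨true⟩,
    Le.prod_le (fun b : ULift.{u} Bool => cond b.down t w) ⟨false⟩⟩

theorem le_mul {D : Term Lb → Prop} {s t w : Term Lb} (h : Le D s t) (k : Le D s w) :
    Le D s (mul t w) :=
  Le.le_prod _ _ (by rintro ⟨_ | _⟩ <;> assumption)

theorem le_add {D : Term Lb → Prop} {t w : Term Lb} : Le D t (add t w) ∧ Le D w (add t w) :=
  ⟨Le.le_sum (fun b : ULift.{u} Bool => cond b.down t w) ⟨true⟩,
    Le.le_sum (fun b : ULift.{u} Bool => cond b.down t w) ⟨false⟩⟩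

theorem add_le {D : Term Lb → Prop} {s t w : Term Lb} (h : Le D t s) (k : Le D w s) :
    Le D (add t w) s :=
  Le.sum_le _ _ (by rintro ⟨_ | _⟩ <;> assumption)

end Term

/-- Causal values: equivalence classes of terms. -/
def Value (Lb : Type u) : Type (u + 1) := Quotient (Term.setoid Lb)

namespace Value

variable {Lb : Type u}

/-- The class `[t]` of a term. -/
def mk (t : Term Lb) : Value Lb := Quotient.mk (Term.setoid Lb) t

instance : PartialOrder (Value Lb) where
  le := Quotient.lift₂ Term.CLe fun _ _ _ _ h k => propext
    ⟨fun l => .trans h.2 (.trans l k.1), fun l => .trans h.1 (.trans l k.2)⟩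
  le_refl v := Quotient.inductionOn v fun t => Term.Le.refl t
  le_trans a b c := Quotient.inductionOn₃ a b c fun _ _ _ => Term.Le.trans
  le_antisymm a b := Quotient.inductionOn₂ a b fun _ _ h k => Quotient.sound ⟨h, k⟩

instance : One (Value Lb) := ⟨mk Term.one⟩

instance : Zero (Value Lb) := ⟨mk Term.zero⟩

instance : Mul (Value Lb) :=
  ⟨Quotient.map₂ Term.mul fun _ _ h _ _ k =>
    ⟨Term.le_mul (.trans Term.mul_le.1 h.1) (.trans Term.mul_le.2 k.1),
      Term.le_mul (.trans Term.mul_le.1 h.2) (.trans Term.mul_le.2 k.2)⟩⟩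

instance : Add (Value Lb) :=
  ⟨Quotient.map₂ Term.add fun _ _ h _ _ k =>
    ⟨Term.add_le (.trans h.1 Term.le_add.1) (.trans k.1 Term.le_add.2),
      Term.add_le (.trans h.2 Term.le_add.1) (.trans k.2 Term.le_add.2)⟩⟩

/-- Application `v · w`. -/
def app : Value Lb → Value Lb → Value Lb :=
  Quotient.map₂ Term.app fun _ _ h _ _ k =>
    ⟨Term.Le.app_congr h.1 h.2 k.1 k.2, Term.Le.app_congr h.2 h.1 k.2 k.1⟩

/-- Negation `∼v`. -/
def neg : Value Lb → Value Lb :=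
  Quotient.map Term.neg fun _ _ h => ⟨Term.Le.neg_congr h.1 h.2, Term.Le.neg_congr h.2 h.1⟩

/-- The sum `∑ i, f i` of a family of values: the class of the sum of any representatives. -/
noncomputable def sum {ι : Type u} (f : ι → Value Lb) : Value Lb :=
  mk (Term.sum fun i => (f i).out)

theorem mk_le_mk {t w : Term Lb} : mk t ≤ mk w ↔ Term.CLe t w := Iff.rfl

theorem mk_out (v : Value Lb) : mk v.out = v := Quotient.out_eq v

theorem mk_sum {ι : Type u} (f : ι → Term Lb) : mk (Term.sum f) = sum fun i => mk (f i) := by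
  have h : ∀ i, mk (Quotient.out (mk (f i))) = mk (f i) := fun i => mk_out _
  apply le_antisymm
  · exact Term.Le.sum_le _ _ fun i => .trans (mk_le_mk.1 (h i).ge)
      (Term.Le.le_sum (fun i => (mk (f i)).out) i)
  · exact Term.Le.sum_le _ _ fun i => .trans (mk_le_mk.1 (h i).le) (Term.Le.le_sum f i)

theorem isLUB_sum {ι : Type u} (f : ι → Value Lb) : IsLUB (Set.range f) (sum f) := by
  constructor
  · rintro _ ⟨i, rfl⟩
    rw [← mk_out (f i)]
    exact Term.Le.le_sum (fun i => (f i).out) i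
  · intro v hv
    rw [← mk_out v]
    refine Term.Le.sum_le _ _ fun i => mk_le_mk.1 ?_
    rw [mk_out, mk_out]
    exact hv ⟨i, rfl⟩

/-- The order is the usual one of the lattice with meet `*`. -/
theorem le_iff_mul_eq (v w : Value Lb) : v ≤ w ↔ v * w = v := by
  induction v using Quotient.inductionOn with | _ t
  induction w using Quotient.inductionOn with | _ s
  constructor
  · intro h
    exact Quotient.sound ⟨Term.mul_le.1, Term.le_mul (.refl _) h⟩
  · intro h
    exact Term.Le.trans (Quotient.exact h).2 Term.mul_le.2

/-- The order is the usual one of the lattice with join `+`. -/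
theorem le_iff_add_eq (v w : Value Lb) : v ≤ w ↔ v + w = w := by
  induction v using Quotient.inductionOn with | _ t
  induction w using Quotient.inductionOn with | _ s
  constructor
  · intro h
    exact Quotient.sound ⟨Term.add_le h (.refl _), Term.le_add.2⟩
  · intro h
    exact Term.Le.trans Term.le_add.1 (Quotient.exact h).1

end Value

/-- A rule `r : H ← B₁, …, Bₘ, not C₁, …, not Cₙ`.  The label `none` stands for `r = 1`; each `Bᵢ`
and each `Cᵢ` is an atom or a term. -/
structure Rule (At Lb : Type u) : Type (u + 1) where
  label : Option Lb
  head : At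
  pos : List (At ⊕ Term Lb)
  neg : List (At ⊕ Term Lb)

/-- A program is a set of rules. -/
abbrev Program (At Lb : Type u) := Set (Rule At Lb)

/-- An interpretation assigns a value to each atom; interpretations are ordered pointwise. -/
abbrev Interpretation (At Lb : Type u) := At → Value Lb

variable {At Lb : Type u}

/-- The value of a rule label. -/
def Rule.labelValue (r : Rule At Lb) : Value Lb :=
  match r.label with
  | some l => Value.mk (Term.label l)
  | none => 1

/-- The value `I(B)` of an atom or a term. -/
def Interpretation.eval (I : Interpretation At Lb) : At ⊕ Term Lb → Value Lb
  | Sum.inl a => I a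
  | Sum.inr t => Value.mk t

/-- All rules are free of default negation. -/
def Program.IsPositive (P : Program At Lb) : Prop := ∀ r ∈ P, r.neg = []

/-- `I` satisfies the rule `r`. -/
def Interpretation.Satisfies (I : Interpretation At Lb) (r : Rule At Lb) : Prop :=
  Value.app ((r.pos.map I.eval).prod * (r.neg.map fun C => (I.eval C).neg).prod) r.labelValue
    ≤ I r.head

/-- `I` is a causal model of `P`. -/
def Interpretation.IsModel (I : Interpretation At Lb) (P : Program At Lb) : Prop :=
  ∀ r ∈ P, I.Satisfies r

/-- The direct consequence operator of a positive program.  The sum ranges over the rules of `P`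
with head `H`; the instance `Small P` says that the rules of `P` form a set rather than a proper
class relative to the universe in which `At`, `Lb` and the index sets of sums live. -/
noncomputable def Program.T (P : Program At Lb) [Small.{u} P] (I : Interpretation At Lb) :
    Interpretation At Lb := fun H =>
  Value.sum fun i : Shrink.{u} {r : P // r.1.head = H} =>
    let r : Rule At Lb := ((equivShrink {r : P // r.1.head = H}).symm i).1.1
    Value.app (r.pos.map I.eval).prod r.labelValue

/-- The iterates `T_P ↑ α`: the sum of all earlier iterates when `α` is zero or a limit, and
`T_P (T_P ↑ (α - 1))` when `α` is a successor. -/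
noncomputable def Program.iter (P : Program At Lb) [Small.{u} P] (α : Ordinal.{u}) :
    Interpretation At Lb :=
  Ordinal.limitRecOn α (motive := fun _ => Interpretation At Lb)
    (fun _ => 0)
    (fun _ I => P.T I)
    (fun β _ I A => Value.sum fun i : Shrink.{u} (Set.Iio β) =>
      I ((equivShrink (Set.Iio β)).symm i).1 ((equivShrink (Set.Iio β)).symm i).2 A)

theorem Program.iter_zero (P : Program At Lb) [Small.{u} P] :
    P.iter 0 = fun _ => 0 := by
  simp [Program.iter]

theorem Program.iter_succ (P : Program At Lb) [Small.{u} P] (α : Ordinal.{u}) :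
    P.iter (Order.succ α) = P.T (P.iter α) := by
  simp [Program.iter]

theorem Program.iter_limit (P : Program At Lb) [Small.{u} P] (α : Ordinal.{u})
    (h : Order.IsSuccLimit α) :
    P.iter α = fun A => Value.sum fun i : Shrink.{u} (Set.Iio α) =>
      P.iter ((equivShrink (Set.Iio α)).symm i).1 A := by
  unfold Program.iter
  rw [Ordinal.limitRecOn_limit _ _ _ _ h]

end ECJ

/-! Part (i) is Kleene iteration. Finite meets distribute over arbitrary sums, and application
preserves sums in its first argument. Hence `T` is monotone and commutes with sums of increasing
sequences: a body is a finite list, so finitely many stages can be replaced by their maximum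
(`prod_map_sum_le`). Stage ω is therefore a fixpoint. By induction every finite stage lies below
every `I` with `T I ≤ I`; such `I` include the fixpoints and are exactly the causal models.

Part (ii) is a pruning argument resting on `app v w ≤ v`: a derivation is worth no more than any
derivation it uses. If a derivation of `H` uses `H` again, its value is absorbed by that of the
inner one, so only derivations without repeated heads along a branch matter, and their height is at
most the number of heads. `iter_le_iter_card_sup` expresses this without derivation trees: `S` holds
the atoms already met on the branch, and `c` bounds what they contribute. -/

namespace ECJ

/-! ### Values as a distributive lattice -/

namespace Value

variable {Lb : Type u}

theorem zero_le' (v : Value Lb) : 0 ≤ v := by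
  induction v using Quotient.inductionOn with | _ t
  exact Term.Le.sum_le _ _ fun i => i.elim

theorem le_one' (v : Value Lb) : v ≤ 1 := by
  induction v using Quotient.inductionOn with | _ t
  exact Term.Le.le_prod _ _ fun i => i.elim

theorem sum_le_iff {ι : Type u} {f : ι → Value Lb} {v : Value Lb} :
    sum f ≤ v ↔ ∀ i, f i ≤ v := by
  rw [isLUB_le_iff (isLUB_sum f)]
  simp [upperBounds]

theorem le_sum {ι : Type u} (f : ι → Value Lb) (i : ι) : f i ≤ sum f :=
  sum_le_iff.1 le_rfl i

theorem mul_le_left' (v w : Value Lb) : v * w ≤ v := by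
  induction v using Quotient.inductionOn with | _ t
  induction w using Quotient.inductionOn with | _ s
  exact Term.mul_le.1

theorem mul_le_right' (v w : Value Lb) : v * w ≤ w := by
  induction v using Quotient.inductionOn with | _ t
  induction w using Quotient.inductionOn with | _ s
  exact Term.mul_le.2

theorem le_mul' {x v w : Value Lb} (h : x ≤ v) (k : x ≤ w) : x ≤ v * w := by
  induction x using Quotient.inductionOn with | _ a
  induction v using Quotient.inductionOn with | _ t
  induction w using Quotient.inductionOn with | _ s
  exact Term.le_mul h k

theorem le_add_left' (v w : Value Lb) : v ≤ v + w := by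
  induction v using Quotient.inductionOn with | _ t
  induction w using Quotient.inductionOn with | _ s
  exact Term.le_add.1

theorem le_add_right' (v w : Value Lb) : w ≤ v + w := by
  induction v using Quotient.inductionOn with | _ t
  induction w using Quotient.inductionOn with | _ s
  exact Term.le_add.2

theorem add_le' {x v w : Value Lb} (h : v ≤ x) (k : w ≤ x) : v + w ≤ x := by
  induction x using Quotient.inductionOn with | _ a
  induction v using Quotient.inductionOn with | _ t
  induction w using Quotient.inductionOn with | _ s
  exact Term.add_le h k

/-- Binary products distribute over arbitrary sums. -/
theorem mul_sum_le {ι : Type u} (v : Value Lb) (f : ι → Value Lb) :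
    v * sum f ≤ sum fun i => v * f i := by
  suffices h : ∀ (t : Term Lb) (g : ι → Term Lb),
      Term.CLe (Term.mul t (Term.sum g)) (Term.sum fun i => Term.mul t (g i)) by
    have h' := mk_le_mk.2 (h v.out fun i => (f i).out)
    have e : ∀ i, mk (Term.mul v.out (f i).out) = v * f i := fun i =>
      congrArg₂ (· * ·) (mk_out v) (mk_out (f i))
    rw [mk_sum] at h'
    simp only [e] at h'
    refine le_trans (le_of_eq ?_) h'
    exact congrArg (· * sum f) (mk_out v).symm
  intro t g
  -- Complete distributivity is applied to two sums: `t` as a one-term sum, and the sum of `g`. A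
  -- choice function then amounts to an index in `ι`.
  let κ : ULift.{u} Bool → Type u := fun b => cond b.down PUnit.{u + 1} ι
  let F : ∀ b, κ b → Term Lb := fun b =>
    match b with
    | ⟨true⟩ => fun _ => t
    | ⟨false⟩ => fun i => g i
  refine .trans (.le_prod (fun b => Term.sum fun j => F b j) _ ?_)
    (.trans (.ax (Term.Ax.distrib F)) (.sum_le _ _ fun k => ?_))
  · rintro ⟨_ | _⟩
    · exact Term.mul_le.2
    · exact .trans Term.mul_le.1 (.le_sum (F ⟨true⟩) PUnit.unit)
  · refine .trans (Term.le_mul (.prod_le (fun b => F b (k b)) ⟨true⟩)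
      (.prod_le (fun b => F b (k b)) ⟨false⟩)) ?_
    exact .le_sum (fun i => Term.mul t (g i)) (k ⟨false⟩)

theorem mul_add_le (v w x : Value Lb) : v * (w + x) ≤ v * w + v * x := by
  let f : ULift.{u} Bool → Value Lb := fun b => cond b.down w x
  have h : w + x ≤ sum f := add_le' (le_sum f ⟨true⟩) (le_sum f ⟨false⟩)
  refine (le_mul' (mul_le_left' _ _) ((mul_le_right' _ _).trans h)).trans
    ((mul_sum_le v f).trans (sum_le_iff.2 ?_))
  rintro ⟨_ | _⟩
  · exact le_add_right' _ _
  · exact le_add_left' _ _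

instance : Lattice (Value Lb) where
  sup := (· + ·)
  inf := (· * ·)
  le_sup_left := le_add_left'
  le_sup_right := le_add_right'
  sup_le _ _ _ := add_le'
  inf_le_left := mul_le_left'
  inf_le_right := mul_le_right'
  le_inf _ _ _ := le_mul'

instance : DistribLattice (Value Lb) :=
  DistribLattice.ofInfSupLe mul_add_le

theorem mul_mono' {v v' w w' : Value Lb} (h : v ≤ v') (k : w ≤ w') : v * w ≤ v' * w' :=
  inf_le_inf h k

theorem mul_comm' (v w : Value Lb) : v * w = w * v :=
  inf_comm v w

theorem mul_one' (v : Value Lb) : v * 1 = v :=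
  (le_iff_mul_eq v 1).1 (le_one' v)

/-! ### Application and the order -/

/-- Application distributes over arbitrary sums in its first argument. -/
theorem sum_app_le {ι : Type u} (f : ι → Value Lb) (w : Value Lb) :
    app (sum f) w ≤ sum fun i => app (f i) w := by
  have h := mk_le_mk.2 (Term.Le.ax (Term.Ax.sum_app (fun i => (f i).out) w.out))
  have e : ∀ i, mk (Term.app (f i).out w.out) = app (f i) w := fun i =>
    congrArg₂ app (mk_out (f i)) (mk_out w)
  rw [mk_sum] at h
  simp only [e] at h
  exact le_trans (le_of_eq (congrArg (app (sum f)) (mk_out w).symm)) h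

theorem app_le_sum {ι : Type u} (f : ι → Value Lb) (w : Value Lb) (i : ι) :
    app (f i) w ≤ app (sum f) w := by
  have h := mk_le_mk.2 (Term.Le.ax_symm (Term.Ax.sum_app (fun i => (f i).out) w.out))
  have e : ∀ i, mk (Term.app (f i).out w.out) = app (f i) w := fun i =>
    congrArg₂ app (mk_out (f i)) (mk_out w)
  rw [mk_sum] at h
  simp only [e] at h
  exact ((le_sum _ i).trans h).trans (le_of_eq (congrArg (app (sum f)) (mk_out w)))

theorem sup_eq_sum (v w : Value Lb) :
    v ⊔ w = sum fun b : ULift.{u} Bool => cond b.down v w := by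
  apply le_antisymm
  · exact sup_le (le_sum (fun b : ULift.{u} Bool => cond b.down v w) ⟨true⟩)
      (le_sum (fun b : ULift.{u} Bool => cond b.down v w) ⟨false⟩)
  · refine sum_le_iff.2 ?_
    rintro ⟨_ | _⟩
    · exact le_sup_right
    · exact le_sup_left

theorem sup_app_le (v w x : Value Lb) : app (v ⊔ w) x ≤ app v x ⊔ app w x := by
  rw [sup_eq_sum]
  refine (sum_app_le _ _).trans (sum_le_iff.2 ?_)
  rintro ⟨_ | _⟩
  · exact le_sup_right
  · exact le_sup_left

/-- The generating rules give congruence only for equivalent terms. Monotonicity comes from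
additivity, since `v ≤ w` means `v ⊔ w = w`. -/
theorem app_mono_left {v w : Value Lb} (h : v ≤ w) (x : Value Lb) : app v x ≤ app w x := by
  have k := app_le_sum (fun b : ULift.{u} Bool => cond b.down v w) x ⟨true⟩
  rwa [← sup_eq_sum, sup_eq_right.2 h] at k

/-- This is the absorption law `t = t + u · t · w` with `u = 1`. It is what makes pruning possible.
-/
theorem app_le_left (v w : Value Lb) : app v w ≤ v := by
  induction v using Quotient.inductionOn with | _ t
  induction w using Quotient.inductionOn with | _ s
  have h : Term.CLe (Term.app t s) (Term.app (Term.app Term.one t) s) :=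
    .app_congr (.ax (.one_app t)) (.ax_symm (.one_app t)) (.refl s) (.refl s)
  exact h.trans (.trans Term.le_add.2 (.ax_symm (.absorb_add t Term.one s)))

/-! ### Finite products over rule bodies -/

theorem prod_map_mono {β : Type*} {f g : β → Value Lb} (h : ∀ b, f b ≤ g b) (l : List β) :
    (l.map f).prod ≤ (l.map g).prod := by
  induction l with
  | nil => exact le_rfl
  | cons b l ih => exact mul_mono' (h b) ih

/-- Distributivity moves an error term `c` common to all body members outside the product. -/
theorem prod_map_sup_le {β : Type*} (f : β → Value Lb) (c : Value Lb) (l : List β) :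
    (l.map fun b => f b ⊔ c).prod ≤ (l.map f).prod ⊔ c := by
  induction l with
  | nil => exact le_sup_left
  | cons b l ih => exact (mul_mono' le_rfl ih).trans (sup_inf_right _ _ _).ge

/-- Finite products commute with sums of increasing sequences. -/
theorem prod_map_sum_le {β : Type*} (f : ℕ → β → Value Lb) (hf : Monotone f) (l : List β) :
    (l.map fun b => sum fun n : ULift.{u} ℕ => f n.down b).prod ≤
      sum fun n : ULift.{u} ℕ => (l.map (f n.down)).prod := by
  induction l with
  | nil => exact le_sum (fun _ : ULift.{u} ℕ => (1 : Value Lb)) ⟨0⟩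
  | cons b l ih =>
    refine (mul_mono' le_rfl ih).trans ((mul_sum_le _ _).trans (sum_le_iff.2 fun m => ?_))
    rw [mul_comm']
    refine (mul_sum_le _ _).trans (sum_le_iff.2 fun n => ?_)
    rw [mul_comm']
    -- The head and the tail of the list may use different stages; monotonicity moves both to the
    -- maximum.
    refine le_trans ?_ (le_sum _ ⟨max m.down n.down⟩)
    exact mul_mono' (hf (le_max_right _ _) b)
      (prod_map_mono (hf (le_max_left _ _)) l)

end Value

variable {At Lb : Type u}

/-! ### The direct consequence operator and models -/

theorem Interpretation.eval_mono {I J : Interpretation At Lb} (h : I ≤ J) :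
    I.eval ≤ J.eval := by
  rintro (a | t)
  · exact h a
  · exact le_rfl

namespace Program

variable (P : Program At Lb) [Small.{u} P]

theorem T_apply_le_iff {I : Interpretation At Lb} {H : At} {v : Value Lb} :
    P.T I H ≤ v ↔
      ∀ r ∈ P, r.head = H → Value.app (r.pos.map I.eval).prod r.labelValue ≤ v := by
  unfold T
  rw [Value.sum_le_iff]
  refine ⟨fun h r hr hH => ?_, fun h i => ?_⟩
  · simpa using h (equivShrink {r : P // r.1.head = H} ⟨⟨r, hr⟩, hH⟩)
  · exact h _ ((equivShrink {r : P // r.1.head = H}).symm i).1.2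
      ((equivShrink {r : P // r.1.head = H}).symm i).2

theorem app_le_T {I : Interpretation At Lb} {r : Rule At Lb} (hr : r ∈ P) :
    Value.app (r.pos.map I.eval).prod r.labelValue ≤ P.T I r.head :=
  P.T_apply_le_iff.1 le_rfl r hr rfl

theorem T_mono : Monotone P.T := fun _ _ h _ =>
  P.T_apply_le_iff.2 fun _ hr hH => hH ▸ (Value.app_mono_left
    (Value.prod_map_mono (Interpretation.eval_mono h) _) _).trans (P.app_le_T hr)

theorem isModel_iff (hP : P.IsPositive) (I : Interpretation At Lb) :
    I.IsModel P ↔ P.T I ≤ I := by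
  have key : ∀ r ∈ P, I.Satisfies r ↔
      Value.app (r.pos.map I.eval).prod r.labelValue ≤ I r.head := by
    intro r hr
    -- The empty negative body contributes the top value `1`, which drops out of the meet.
    simp only [Interpretation.Satisfies, hP r hr, List.map_nil, List.prod_nil, Value.mul_one']
  constructor
  · intro h H
    exact P.T_apply_le_iff.2 fun r hr hH => hH ▸ (key r hr).1 (h r hr)
  · intro h r hr
    exact (key r hr).2 ((P.app_le_T hr).trans (h r.head))

/-! ### Finite stages and stage ω -/

theorem iter_natCast_zero : P.iter ((0 : ℕ) : Ordinal.{u}) = fun _ => 0 := by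
  rw [Nat.cast_zero, iter_zero]

theorem iter_natCast_succ (n : ℕ) : P.iter ((n + 1 : ℕ) : Ordinal.{u}) = P.T (P.iter n) := by
  rw [Nat.cast_succ, ← Order.succ_eq_add_one, iter_succ]

theorem iter_natCast_mono : Monotone fun n : ℕ => P.iter (n : Ordinal.{u}) := by
  refine monotone_nat_of_le_succ fun n => ?_
  induction n with
  | zero =>
    rw [iter_natCast_zero]
    exact fun _ => Value.zero_le' _
  | succ n ih =>
    rw [iter_natCast_succ, iter_natCast_succ]
    exact P.T_mono ih

theorem iter_omega0 (A : At) : P.iter Ordinal.omega0 A =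
    Value.sum fun n : ULift.{u} ℕ => P.iter (n.down : Ordinal.{u}) A := by
  rw [iter_limit _ _ Ordinal.isSuccLimit_omega0]
  apply le_antisymm
  · refine Value.sum_le_iff.2 fun i => ?_
    obtain ⟨n, hn⟩ := Ordinal.lt_omega0.1 ((equivShrink (Set.Iio Ordinal.omega0)).symm i).2
    rw [hn]
    exact Value.le_sum (fun n : ULift.{u} ℕ => P.iter (n.down : Ordinal.{u}) A) ⟨n⟩
  · refine Value.sum_le_iff.2 fun n => ?_
    have h := Value.le_sum (fun i : Shrink.{u} (Set.Iio Ordinal.omega0.{u}) =>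
      P.iter ((equivShrink (Set.Iio Ordinal.omega0)).symm i).1 A)
      (equivShrink _ ⟨n.down, Ordinal.natCast_lt_omega0 n.down⟩)
    simpa using h

theorem iter_omega0_le_iff {I : Interpretation At Lb} :
    P.iter Ordinal.omega0 ≤ I ↔ ∀ n : ℕ, P.iter (n : Ordinal.{u}) ≤ I := by
  simp only [Pi.le_def, iter_omega0, Value.sum_le_iff]
  exact ⟨fun h n A => h A ⟨n⟩, fun h A n => h n.down A⟩

/-- Asking only for a prefixed point lets this serve leastness among fixpoints and among models
alike. -/
theorem iter_natCast_le_of_T_le {I : Interpretation At Lb} (h : P.T I ≤ I) (n : ℕ) :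
    P.iter (n : Ordinal.{u}) ≤ I := by
  induction n with
  | zero =>
    rw [iter_natCast_zero]
    exact fun _ => Value.zero_le' _
  | succ n ih =>
    rw [iter_natCast_succ]
    exact (P.T_mono ih).trans h

theorem eval_iter_omega0_le (B : At ⊕ Term Lb) : (P.iter Ordinal.omega0).eval B ≤
    Value.sum fun n : ULift.{u} ℕ => (P.iter (n.down : Ordinal.{u})).eval B := by
  cases B with
  | inl a => exact (P.iter_omega0 a).le
  -- A term has the same value at every stage, so any index will do.
  | inr t => exact Value.le_sum (fun _ : ULift.{u} ℕ => Value.mk t) ⟨0⟩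

theorem T_iter_omega0 : P.T (P.iter Ordinal.omega0) = P.iter Ordinal.omega0 := by
  apply le_antisymm
  · refine fun H => P.T_apply_le_iff.2 fun r hr hH => ?_
    subst hH
    refine (Value.app_mono_left ((Value.prod_map_mono P.eval_iter_omega0_le _).trans
      (Value.prod_map_sum_le (fun n => (P.iter (n : Ordinal.{u})).eval)
        (fun _ _ h => Interpretation.eval_mono (P.iter_natCast_mono h)) _)) _).trans ?_
    -- With the sum pulled out of the body and of the application, the summand at `n` lies below
    -- stage `n + 1`.
    refine (Value.sum_app_le _ _).trans (Value.sum_le_iff.2 fun n => (P.app_le_T hr).trans ?_)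
    rw [← iter_natCast_succ]
    exact P.iter_omega0_le_iff.1 le_rfl _ _
  · refine P.iter_omega0_le_iff.2 fun n => (P.iter_natCast_mono n.le_succ).trans ?_
    rw [Nat.succ_eq_add_one]
    simp only [iter_natCast_succ]
    exact P.T_mono (P.iter_omega0_le_iff.1 le_rfl n)

/-! ### Pruning repeated heads -/

open Classical in
/-- A derivation that uses an atom of `S` has at most the value of that atom; any other derivation
may be pruned until no head is repeated along a branch. -/
theorem iter_le_iter_card_sup (heads : Finset At) (hh : ∀ r ∈ P, r.head ∈ heads) (m : ℕ)
    (S : Finset At) (c : Value Lb) (hc : ∀ s ∈ S, P.iter (m : Ordinal.{u}) s ≤ c) (H : At) :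
    P.iter (m : Ordinal.{u}) H ≤ P.iter ((heads \ S).card : Ordinal.{u}) H ⊔ c := by
  induction m generalizing S c H with
  | zero =>
    rw [iter_natCast_zero]
    exact Value.zero_le' _
  | succ m ih =>
    by_cases hS : H ∈ S
    · exact (hc H hS).trans le_sup_right
    have hc' : ∀ s ∈ S, P.iter (m : Ordinal.{u}) s ≤ c := fun s hs =>
      (P.iter_natCast_mono m.le_succ s).trans (hc s hs)
    rw [iter_natCast_succ]
    refine P.T_apply_le_iff.2 fun r hr hH => ?_
    have hmem : H ∈ heads \ S := Finset.mem_sdiff.2 ⟨hH ▸ hh r hr, hS⟩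
    -- Marking `H` as met costs exactly one stage, which the application of `T` at `H` restores.
    have hcard : (heads \ S).card = (heads \ insert H S).card + 1 := by
      rw [← Finset.card_erase_add_one hmem, Finset.sdiff_insert]
    -- Below this occurrence of `H`, further uses of `H` are charged to the bound, which therefore
    -- grows by the value of `H` at stage `m`.
    have hbody : ∀ B, (P.iter (m : Ordinal.{u})).eval B ≤
        (P.iter ((heads \ insert H S).card : Ordinal.{u})).eval B ⊔
          (c ⊔ P.iter (m : Ordinal.{u}) H) := by
      rintro (a | t)
      · refine ih (insert H S) _ (fun s hs => ?_) a
        rcases Finset.mem_insert.1 hs with rfl | hs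
        · exact le_sup_right
        · exact (hc' s hs).trans le_sup_left
      · exact le_sup_left
    refine (Value.app_mono_left ((Value.prod_map_mono hbody _).trans
      (Value.prod_map_sup_le _ _ _)) _).trans ((Value.sup_app_le _ _ _).trans ?_)
    -- The label can only shrink the error term. Its part `P.iter m H` is removed by the induction
    -- hypothesis once more, now at `H` with the original `S` and `c`.
    refine sup_le ((P.app_le_T hr).trans ?_) ((Value.app_le_left _ _).trans
      (sup_le le_sup_right (ih S c hc' H)))
    rw [← iter_natCast_succ, ← hcard, hH]
    exact le_sup_left

end Program

end ECJ

theorem mainTheorem1 {At Lb : Type u} (P : ECJ.Program At Lb) [Small.{u} P]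
    (hP : P.IsPositive) :
    ∃ L : ECJ.Interpretation At Lb,
      IsLeast {I | P.T I = I} L ∧
      L = P.iter Ordinal.omega0 ∧
      IsLeast {I | I.IsModel P} L ∧
      ∀ n : ℕ, Set.encard P = n → L = P.iter Ordinal.omega0 ∧ P.iter Ordinal.omega0 = P.iter n := by
  classical
  refine ⟨P.iter Ordinal.omega0, ⟨P.T_iter_omega0, fun I hI => ?_⟩, rfl,
    ⟨(P.isModel_iff hP _).2 P.T_iter_omega0.le, fun I hI => ?_⟩, fun n hn => ⟨rfl, ?_⟩⟩
  · exact P.iter_omega0_le_iff.2 (P.iter_natCast_le_of_T_le (le_of_eq hI))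
  · exact P.iter_omega0_le_iff.2 (P.iter_natCast_le_of_T_le ((P.isModel_iff hP I).1 hI))
  · refine le_antisymm (P.iter_omega0_le_iff.2 fun m H => ?_) (P.iter_omega0_le_iff.1 le_rfl n)
    have hfin : P.Finite := Set.finite_of_encard_eq_coe hn
    -- Pruning bounds the height by the number of distinct heads, which is at most the number of
    -- rules.
    have hcard : (hfin.toFinset.image ECJ.Rule.head).card ≤ n := by
      refine Finset.card_image_le.trans ?_
      rw [hfin.encard_eq_coe_toFinset_card] at hn
      exact_mod_cast hn.le
    -- At the root no atom has been met, so `S = ∅` and `c = 0`, and the join with `c` disappears.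
    have h := P.iter_le_iter_card_sup (hfin.toFinset.image ECJ.Rule.head)
      (fun r hr => Finset.mem_image_of_mem _ (hfin.mem_toFinset.2 hr)) m ∅ 0 (by simp) H
    rw [Finset.sdiff_empty, sup_eq_left.2 (ECJ.Value.zero_le' _)] at h
    exact h.trans (P.iter_natCast_mono hcard H)
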